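/- Let $A$ be a Stein manifold, that is, a Hausdorff, second countable, finite-dimensional complex manifold that is holomorphically convex and whose global holomorphic functions separate points. Let $X\subset A$ be a domain (a non-empty connected open subset, not assumed to be relatively compact in $A$), let $U$ be an open subset of $X$ that is relatively compact in $X$, and let $f:X\to U$ be a holomorphic map. Then $f$ has a unique fixed point $c$ in $X$, the point $c$ lies in $U$, and the sequence of iterates $(f^{n})$ converges to the constant map $z\mapsto c$ for the compact-open topology on the continuous maps $X\to X$. In particular (Hervé), for every $n$, if $\Omega$ is a domain in $\mathbb{C}^{n}$, $K$ is a compact subset of $\Omega$, and $f:\Omega\to\mathbb{C}^n$ is holomorphic with $f(\Omega)\subset K$, then $f$ has a unique fixed point in $\Omega$. -/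

import Mathlib

open scoped Manifold ContDiff Topology

/-- The holomorphic functions `A → ℂ` on a complex manifold `A` modelled on `E`. -/
def holomorphicFunctions (E : Type*) [NormedAddCommGroup E] [NormedSpace ℂ E]
    (A : Type*) [TopologicalSpace A] [ChartedSpace E A] : Set (A → ℂ) :=
  {g | MDifferentiable 𝓘(ℂ, E) 𝓘(ℂ, ℂ) g}

/-- The holomorphically convex hull of `K` in `A`: the points `x` such that
`|g x| ≤ sup_K |g|` for every holomorphic function `g` on `A`.
The supremum is expressed through upper bounds. -/
def holomorphicHull (E : Type*) [NormedAddCommGroup E] [NormedSpace ℂ E]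
    {A : Type*} [TopologicalSpace A] [ChartedSpace E A] (K : Set A) : Set A :=
  {x | ∀ g ∈ holomorphicFunctions E A, ∀ r : ℝ, (∀ y ∈ K, ‖g y‖ ≤ r) → ‖g x‖ ≤ r}

/-- A Stein manifold: a Hausdorff, second countable complex manifold of finite dimension
(modelled on `E`) that is holomorphically convex and whose global holomorphic functions
separate points. -/
structure IsSteinManifold (E : Type*) [NormedAddCommGroup E] [NormedSpace ℂ E]
    (A : Type*) [TopologicalSpace A] [ChartedSpace E A] : Prop where
  finiteDimensional : FiniteDimensional ℂ E
  isManifold : IsManifold 𝓘(ℂ, E) ω A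
  t2Space : T2Space A
  secondCountable : SecondCountableTopology A
  isCompact_hull : ∀ K : Set A, IsCompact K → IsCompact (holomorphicHull E K)
  separates : ∀ x y : A, x ≠ y → ∃ g ∈ holomorphicFunctions E A, g x ≠ g y

open Set Filter Metric

/-! Only disc-valued functions on a relatively compact neighbourhood V of the compact set K
containing the image of f are needed. By Schwarz–Pick, chained along connectedness
(`IsCompact.exists_hasHarnackBound`), such a g vanishing at a point of K has |g| ≤ s < 1 on K. As f
maps into K, g ∘ f divided by some r < 1 is again a disc map, so induction yields a contraction by r
^ n (`HasHarnackBound.exists_norm_iterate_le`). Global functions are bounded on V and, rescaled,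
separate points; hence the decreasing compact sets f^n(K) meet in one point, the fixed point, and
compactness gives uniform convergence. -/

/-- In a preconnected space, a property of sets that is inherited by subsets, holds on a
neighbourhood of each point, and passes to unions of overlapping sets holds for compact sets. -/
theorem IsCompact.induction_of_preconnected {M : Type*} [TopologicalSpace M]
    [PreconnectedSpace M] [Nonempty M] {P : Set M → Prop}
    (mono : ∀ S T, S ⊆ T → P T → P S) (loc : ∀ x, ∃ N ∈ 𝓝 x, P N)
    (union : ∀ S T, (S ∩ T).Nonempty → P S → P T → P (S ∪ T))
    {K : Set M} (hK : IsCompact K) : P K := by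
  obtain ⟨a⟩ := ‹Nonempty M›
  -- This set is clopen: x and a nearby y share a set N with P, which links {x, a} to {y, a} in both
  -- directions.
  have huniv : {x | P {x, a}} = univ := by
    refine IsClopen.eq_univ ⟨⟨isOpen_iff_mem_nhds.2 fun x hx => ?_⟩,
      isOpen_iff_mem_nhds.2 fun x hx => ?_⟩ ⟨a, ?_⟩
    · obtain ⟨N, hN, hPN⟩ := loc x
      refine mem_of_superset hN fun y hy hPy => hx ?_
      refine mono _ (N ∪ {y, a}) ?_ (union N {y, a} ⟨y, hy, by simp⟩ hPN hPy)
      have := mem_of_mem_nhds hN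
      rintro z (rfl | rfl) <;> simp [this]
    · obtain ⟨N, hN, hPN⟩ := loc x
      refine mem_of_superset hN fun y hy => ?_
      refine mono _ (N ∪ {x, a}) ?_ (union N {x, a} ⟨x, mem_of_mem_nhds hN, by simp⟩ hPN hx)
      rintro z (rfl | rfl) <;> simp [hy]
    · obtain ⟨N, hN, hPN⟩ := loc a
      refine mono _ N ?_ hPN
      have := mem_of_mem_nhds hN
      rintro z (rfl | rfl) <;> exact this
  have hmem : ∀ x, P {x, a} := fun x => huniv.symm.subset (mem_univ x)
  refine mono K (K ∪ {a}) subset_union_left ?_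
  refine hK.induction_on (p := fun S => P (S ∪ {a})) ?_ ?_ ?_ ?_
  · exact mono _ _ (by simp) (hmem a)
  · exact fun S T h hT => mono _ _ (union_subset_union_left _ h) hT
  · exact fun S T hS hT => mono _ _ (by grind)
      (union (S ∪ {a}) (T ∪ {a}) ⟨a, by simp, by simp⟩ hS hT)
  · intro x _
    obtain ⟨N, hN, hPN⟩ := loc x
    exact ⟨N, mem_nhdsWithin_of_mem_nhds hN, mono _ _ (by grind)
      (union N {x, a} ⟨x, mem_of_mem_nhds hN, by simp⟩ hPN (hmem x))⟩

open ComplexConjugate in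
theorem Complex.normSq_one_sub_conj_mul_sub (a w : ℂ) :
    ‖1 - conj a * w‖ ^ 2 - ‖w - a‖ ^ 2 = (1 - ‖a‖ ^ 2) * (1 - ‖w‖ ^ 2) := by
  simp only [Complex.sq_norm, Complex.normSq_apply, Complex.sub_re, Complex.sub_im,
    Complex.mul_re, Complex.mul_im, Complex.conj_re, Complex.conj_im, Complex.one_re,
    Complex.one_im]
  ring

open ComplexConjugate in
/-- A two-point bound of Schwarz–Pick type for maps into the unit disc. -/
theorem Complex.norm_le_of_norm_lt_one {E : Type*} [NormedAddCommGroup E] [NormedSpace ℂ E]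
    {u : E → ℂ} {p q : E} {R : ℝ} (hu : DifferentiableOn ℂ u (ball p R))
    (hlt : ∀ z ∈ ball p R, ‖u z‖ < 1) (hR : 0 < R) (hpq : dist q p ≤ 2 / 3 * R)
    {η : ℝ} (hη : η < 1) (hp : ‖u p‖ ≤ η) : ‖u q‖ ^ 2 ≤ 1 - 5 / 9 * (1 - η) ^ 2 := by
  have hqmem : q ∈ ball p R := by rw [mem_ball]; linarith
  have hpmem : p ∈ ball p R := mem_ball_self hR
  set a := u p with ha
  have ha1 : ‖a‖ < 1 := hlt p hpmem
  have hbound : ∀ w : ℂ, ‖w‖ < 1 → 1 - ‖a‖ ≤ ‖1 - conj a * w‖ := fun w hw => by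
    have h1 := norm_sub_norm_le (1 : ℂ) (conj a * w)
    rw [norm_mul, RCLike.norm_conj, norm_one] at h1
    nlinarith [norm_nonneg a, norm_nonneg w]
  have hne : ∀ z ∈ ball p R, 1 - conj a * u z ≠ 0 := fun z hz h => by
    have := hbound _ (hlt z hz)
    rw [h, norm_zero] at this
    linarith
  -- Compose with the disc automorphism sending a to 0, so that the Schwarz lemma applies at p.
  let v : E → ℂ := fun z => (u z - a) / (1 - conj a * u z)
  have hv : DifferentiableOn ℂ v (ball p R) :=
    ((hu.sub_const a).mul (((hu.const_mul _).const_sub 1).inv hne)).congr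
      fun z _ => div_eq_mul_inv _ _
  have hvp : v p = 0 := by simp [v, ha]
  have hmaps : MapsTo v (ball p R) (closedBall (v p) 1) := fun z hz => by
    rw [hvp, mem_closedBall_zero_iff, norm_div,
      div_le_one (norm_pos_iff.2 (hne z hz))]
    refine (sq_le_sq₀ (norm_nonneg _) (norm_nonneg _)).1 ?_
    have := Complex.normSq_one_sub_conj_mul_sub a (u z)
    have h2 := hlt z hz
    have : 0 ≤ (1 - ‖a‖ ^ 2) * (1 - ‖u z‖ ^ 2) := by
      apply mul_nonneg <;> nlinarith [norm_nonneg a, norm_nonneg (u z)]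
    linarith
  have hS := Complex.dist_le_div_mul_dist_of_mapsTo_ball hv hmaps hqmem
  rw [hvp, dist_zero_right, norm_div, div_le_iff₀ (norm_pos_iff.2 (hne q hqmem))] at hS
  have h23 : 1 / R * dist q p ≤ 2 / 3 := by
    rw [one_div, inv_mul_le_iff₀ hR]; linarith
  have hb := hbound _ (hlt q hqmem)
  have hS' : ‖u q - a‖ ≤ 2 / 3 * ‖1 - conj a * u q‖ :=
    hS.trans (mul_le_mul_of_nonneg_right h23 (norm_nonneg _))
  have hid := Complex.normSq_one_sub_conj_mul_sub a (u q)
  have hsq : ‖u q - a‖ ^ 2 ≤ 4 / 9 * ‖1 - conj a * u q‖ ^ 2 := by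
    nlinarith [norm_nonneg (u q - a)]
  have hq1 := hlt q hqmem
  have hqq : 0 ≤ 1 - ‖u q‖ ^ 2 := by nlinarith [norm_nonneg (u q)]
  have h3 : (1 - η) ^ 2 ≤ ‖1 - conj a * u q‖ ^ 2 :=
    pow_le_pow_left₀ (by linarith) (by linarith) 2
  -- Here 5/9 = 1 - (2/3)², and `hid` bounds 1 - ‖u q‖² below because 1 - ‖a‖² ≤ 1.
  nlinarith [mul_nonneg (sq_nonneg ‖a‖) hqq]

theorem eq_of_forall_mem_nhds_of_iterate_mem {M : Type*} [TopologicalSpace M] [T1Space M]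
    {f : M → M} {x c : M} (hx : f x = x)
    (h : ∀ W ∈ 𝓝 c, ∀ᶠ n in atTop, ∀ x, f^[n] x ∈ W) : x = c := by
  by_contra hne
  obtain ⟨n, hn⟩ := (h _ (isOpen_compl_singleton.mem_nhds (Ne.symm hne))).exists
  exact hn x (Function.iterate_fixed hx n)

section Manifold

variable {E : Type*} [NormedAddCommGroup E] [NormedSpace ℂ E]
  {M : Type*} [TopologicalSpace M] [ChartedSpace E M]

/-- The holomorphic maps from `V` to the open unit disc (as functions on the ambient manifold). -/
def discMaps (E : Type*) [NormedAddCommGroup E] [NormedSpace ℂ E]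
    {M : Type*} [TopologicalSpace M] [ChartedSpace E M] (V : Set M) : Set (M → ℂ) :=
  {g | MDifferentiableOn 𝓘(ℂ, E) 𝓘(ℂ, ℂ) g V ∧ ∀ z ∈ V, ‖g z‖ < 1}

theorem discMaps_anti {V W : Set M} (h : V ⊆ W) : discMaps E W ⊆ discMaps E V :=
  fun _ hg => ⟨hg.1.mono h, fun z hz => hg.2 z (h hz)⟩

/-- A Harnack property: a bound away from `1` at one point of `S` for the maps from `V` to the
disc yields a uniform bound away from `1` on `S`. -/
def HasHarnackBound (E : Type*) [NormedAddCommGroup E] [NormedSpace ℂ E]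
    {M : Type*} [TopologicalSpace M] [ChartedSpace E M] (V S : Set M) : Prop :=
  ∀ η < (1 : ℝ), ∃ r < (1 : ℝ), ∀ g ∈ discMaps E V, ∀ p ∈ S, ∀ q ∈ S, ‖g p‖ ≤ η → ‖g q‖ ≤ r

theorem HasHarnackBound.mono {V W S T : Set M} (hVW : V ⊆ W) (hTS : T ⊆ S)
    (h : HasHarnackBound E V S) : HasHarnackBound E W T := fun η hη => by
  obtain ⟨r, hr, H⟩ := h η hη
  exact ⟨r, hr, fun g hg p hp q hq => H g (discMaps_anti hVW hg) p (hTS hp) q (hTS hq)⟩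

theorem HasHarnackBound.union {V S T : Set M} (hST : (S ∩ T).Nonempty)
    (hS : HasHarnackBound E V S) (hT : HasHarnackBound E V T) :
    HasHarnackBound E V (S ∪ T) := fun η hη => by
  obtain ⟨m, hmS, hmT⟩ := hST
  obtain ⟨r₁, hr₁, H₁⟩ := hS η hη
  obtain ⟨r₂, hr₂, H₂⟩ := hT η hη
  -- If p and q lie in different sets, the bound passes through the common point m, so the first
  -- output becomes the second input.
  obtain ⟨r₃, hr₃, H₃⟩ := hS r₂ hr₂
  obtain ⟨r₄, hr₄, H₄⟩ := hT r₁ hr₁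
  refine ⟨max (max r₁ r₂) (max r₃ r₄), by simp [*], fun g hg p hp q hq hpη => ?_⟩
  rcases hp with hp | hp <;> rcases hq with hq | hq
  · have := H₁ g hg p hp q hq hpη
    grind
  · have := H₄ g hg m hmT q hq (H₁ g hg p hp m hmS hpη)
    grind
  · have := H₃ g hg m hmS q hq (H₂ g hg p hp m hmT hpη)
    grind
  · have := H₂ g hg p hp q hq hpη
    grind

theorem exists_nhds_hasHarnackBound [FiniteDimensional ℂ E] [IsManifold 𝓘(ℂ, E) 1 M] (x : M) :
    ∃ N ∈ 𝓝 x, ∃ V L : Set M, IsOpen V ∧ N ⊆ V ∧ V ⊆ L ∧ IsCompact L ∧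
      HasHarnackBound E V N := by
  have : ProperSpace E := FiniteDimensional.proper ℂ E
  set φ := chartAt E x
  obtain ⟨R, hR, hRt⟩ := Metric.nhds_basis_closedBall.mem_iff.1
    (φ.open_target.mem_nhds (mem_chart_target E x))
  have hbt : ∀ {r}, r ≤ R → ball (φ x) r ⊆ φ.target := fun h =>
    (ball_subset_ball h).trans (ball_subset_closedBall.trans hRt)
  have hopen : ∀ {r}, r ≤ R → IsOpen (φ.symm '' ball (φ x) r) := fun h =>
    φ.symm.isOpen_image_of_subset_source isOpen_ball (hbt h)
  have hx : φ.symm (φ x) = x := φ.left_inv (mem_chart_source E x)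
  -- Points p, q of the R/4-ball are within R/2 = 2/3 · (3/4 R), and the ball of radius 3/4 R about
  -- p stays in the R-ball.
  refine ⟨φ.symm '' ball (φ x) (R / 4),
    (hopen (by linarith)).mem_nhds ⟨φ x, mem_ball_self (by linarith), hx⟩,
    φ.symm '' ball (φ x) R, φ.symm '' closedBall (φ x) R, hopen le_rfl,
    image_mono (ball_subset_ball (by linarith)), image_mono ball_subset_closedBall,
    (isCompact_closedBall _ _).image_of_continuousOn (φ.symm.continuousOn.mono hRt), ?_⟩
  intro η hη
  refine ⟨√(1 - 5 / 9 * (1 - η) ^ 2), ?_, ?_⟩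
  · rw [Real.sqrt_lt' one_pos]
    have : 0 < (1 - η) ^ 2 := by have : 0 < 1 - η := by linarith
                                 positivity
    linarith
  rintro g ⟨hg, hg1⟩ _ ⟨p, hp, rfl⟩ _ ⟨q, hq, rfl⟩ hpη
  rw [mem_ball] at hp hq
  have hsub : ball p (3 / 4 * R) ⊆ ball (φ x) R := ball_subset_ball' (by linarith)
  have hd : DifferentiableOn ℂ (g ∘ φ.symm) (ball (φ x) R) :=
    (hg.comp ((mdifferentiableOn_atlas_symm (chart_mem_atlas E x)).mono (hbt le_rfl))
      (fun z hz => mem_image_of_mem _ hz)).differentiableOn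
  refine Real.le_sqrt_of_sq_le (Complex.norm_le_of_norm_lt_one (hd.mono hsub)
    (fun z hz => hg1 _ (mem_image_of_mem _ (hsub hz))) (by linarith) ?_ hη hpη)
  have := dist_triangle_right q p (φ x)
  linarith

/-- On a connected complex manifold, every compact set has a relatively compact open
neighbourhood whose maps to the disc satisfy a Harnack bound on the compact set. -/
theorem IsCompact.exists_hasHarnackBound [FiniteDimensional ℂ E] [IsManifold 𝓘(ℂ, E) 1 M]
    [ConnectedSpace M] {K : Set M} (hK : IsCompact K) :
    ∃ V L : Set M, IsOpen V ∧ K ⊆ V ∧ V ⊆ L ∧ IsCompact L ∧ HasHarnackBound E V K := by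
  refine hK.induction_of_preconnected (P := fun S => ∃ V L : Set M, IsOpen V ∧ S ⊆ V ∧ V ⊆ L ∧
    IsCompact L ∧ HasHarnackBound E V S) ?_ exists_nhds_hasHarnackBound ?_
  · rintro S T hST ⟨V, L, hV, hTV, hVL, hL, hB⟩
    exact ⟨V, L, hV, hST.trans hTV, hVL, hL, hB.mono Subset.rfl hST⟩
  · rintro S T hST ⟨V, L, hV, hSV, hVL, hL, hB⟩ ⟨V', L', hV', hTV', hVL', hL', hB'⟩
    exact ⟨V ∪ V', L ∪ L', hV.union hV', union_subset_union hSV hTV',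
      union_subset_union hVL hVL', hL.union hL',
      (hB.mono subset_union_left Subset.rfl).union hST (hB'.mono subset_union_right Subset.rfl)⟩

/-- The iterates of a holomorphic map into a compact set contract geometrically the
pseudohyperbolic distance given by maps to the disc. -/
theorem HasHarnackBound.exists_norm_iterate_le {V K : Set M} (hKV : K ⊆ V)
    (hB : HasHarnackBound E V K) {f : M → M} (hf : MDifferentiable 𝓘(ℂ, E) 𝓘(ℂ, E) f)
    (hfK : ∀ x, f x ∈ K) :
    ∃ r : ℝ, 0 ≤ r ∧ r < 1 ∧ ∀ n : ℕ, ∀ g ∈ discMaps E V, ∀ x ∈ V, ∀ y ∈ V,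
      g (f^[n] x) = 0 → ‖g (f^[n] y)‖ ≤ r ^ n := by
  obtain ⟨s, hs, H⟩ := hB 0 one_pos
  -- Strictly above s, so that g ∘ f / r has norm < 1; strictly above 0, to allow the division.
  obtain ⟨r, hr, hr1⟩ := exists_between (max_lt hs one_pos)
  obtain ⟨hsr, hr0⟩ := max_lt_iff.1 hr
  refine ⟨r, hr0.le, hr1, fun n => ?_⟩
  have hfV : ∀ n : ℕ, ∀ z ∈ V, f^[n] z ∈ V := fun n z hz => by
    cases n with
    | zero => exact hz
    | succ n => rw [Function.iterate_succ_apply']; exact hKV (hfK _)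
  induction n with
  | zero => intro g hg x _ y hy _; simpa using (hg.2 y hy).le
  | succ n ih =>
    intro g hg x hx y hy hgx
    rw [Function.iterate_succ_apply'] at hgx ⊢
    have hmem : (fun z => (r : ℂ)⁻¹ • g (f z)) ∈ discMaps E V := by
      refine ⟨?_, fun z _ => ?_⟩
      · exact (hg.1.comp hf.mdifferentiableOn fun z _ => hKV (hfK z)).const_smul _
      · have := H g hg _ (hfK (f^[n] x)) _ (hfK z) (by rw [hgx, norm_zero])
        rw [norm_smul, norm_inv, Complex.norm_real, Real.norm_of_nonneg hr0.le,
          inv_mul_lt_iff₀ hr0]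
        linarith
    have := ih _ hmem x hx y hy (by simp [hgx])
    rw [norm_smul, norm_inv, Complex.norm_real, Real.norm_of_nonneg hr0.le,
      inv_mul_le_iff₀ hr0] at this
    rwa [pow_succ']

/-- A holomorphic self-map with relatively compact image of a connected complex manifold whose
holomorphic functions separate points has iterates that converge uniformly to a fixed point. -/
theorem MDifferentiable.exists_fixedPoint_iterate_mem [FiniteDimensional ℂ E]
    [IsManifold 𝓘(ℂ, E) 1 M] [T2Space M] [ConnectedSpace M]
    (hsep : ∀ x y : M, x ≠ y → ∃ g : M → ℂ, MDifferentiable 𝓘(ℂ, E) 𝓘(ℂ, ℂ) g ∧ g x ≠ g y)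
    {K : Set M} (hK : IsCompact K) {f : M → M} (hf : MDifferentiable 𝓘(ℂ, E) 𝓘(ℂ, E) f)
    (hfK : ∀ x, f x ∈ K) :
    ∃ c, f c = c ∧ ∀ W ∈ 𝓝 c, ∀ᶠ n in atTop, ∀ x, f^[n] x ∈ W := by
  obtain ⟨V, L, -, hKV, hVL, hL, hB⟩ := hK.exists_hasHarnackBound (E := E)
  obtain ⟨r, hr0, hr1, H⟩ := hB.exists_norm_iterate_le hKV hf hfK
  set Z : ℕ → Set M := fun n => f^[n] '' K
  have hZc : ∀ n, IsCompact (Z n) := fun n => hK.image (hf.continuous.iterate n)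
  have hanti : Antitone Z := antitone_nat_of_succ_le fun n => by
    rintro _ ⟨x, -, rfl⟩
    exact ⟨f x, hfK x, rfl⟩
  have hdir : Directed (· ⊇ ·) Z := directed_of_isDirected_le fun _ _ h => hanti h
  have hne : (⋂ n, Z n).Nonempty :=
    IsCompact.nonempty_iInter_of_directed_nonempty_isCompact_isClosed Z hdir
      (fun n => Set.Nonempty.image _ ⟨_, hfK (Classical.arbitrary M)⟩) hZc
      fun n => (hZc n).isClosed
  obtain ⟨c, hc⟩ := hne
  have hsub : ∀ q ∈ ⋂ n, Z n, q = c := by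
    intro q hq
    by_contra hqc
    obtain ⟨g, hg, hgne⟩ := hsep q c hqc
    obtain ⟨B, hBd⟩ := hL.exists_bound_of_continuousOn hg.continuous.continuousOn
    rw [mem_iInter] at hc hq
    have hZV : Z 0 ⊆ V := by simpa [Z] using hKV
    have hcV : c ∈ V := hZV (hc 0)
    have hB0 : 0 ≤ B := (norm_nonneg _).trans (hBd c (hVL hcV))
    have hpos : (0 : ℝ) < 2 * B + 1 := by linarith
    have hmem : (fun z => ((2 * B + 1 : ℝ) : ℂ)⁻¹ • (g z - g c)) ∈ discMaps E V := by
      refine ⟨((hg.sub mdifferentiable_const).const_smul _).mdifferentiableOn, fun z hz => ?_⟩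
      rw [norm_smul, norm_inv, Complex.norm_real, Real.norm_of_nonneg hpos.le,
        inv_mul_lt_iff₀ hpos]
      have := norm_sub_le (g z) (g c)
      have := hBd z (hVL hz)
      have := hBd c (hVL hcV)
      linarith
    have hle : ∀ n : ℕ, ‖((2 * B + 1 : ℝ) : ℂ)⁻¹ • (g q - g c)‖ ≤ r ^ n := fun n => by
      obtain ⟨x, hx, hxc⟩ := hc n
      obtain ⟨y, hy, hyq⟩ := hq n
      have := H n _ hmem x (hKV hx) y (hKV hy) (by simp [hxc])
      rwa [hyq] at this
    have h0 := ge_of_tendsto' (tendsto_pow_atTop_nhds_zero_of_lt_one hr0 hr1) hle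
    rw [norm_le_zero_iff, smul_eq_zero, inv_eq_zero, Complex.ofReal_eq_zero, sub_eq_zero] at h0
    exact h0.elim hpos.ne' hgne
  refine ⟨c, hsub _ (mem_iInter.2 fun n => ?_), fun W hW => ?_⟩
  · obtain ⟨x, -, hx⟩ := mem_iInter.1 hc n
    exact ⟨f x, hfK x, by rw [← hx, ← Function.iterate_succ_apply, Function.iterate_succ_apply']⟩
  · obtain ⟨n, hn⟩ := exists_subset_nhds_of_isCompact hdir hZc (fun q hq => hsub q hq ▸ hW)
    -- The extra iterate brings an arbitrary x into K.
    filter_upwards [eventually_ge_atTop (n + 1)] with m hm x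
    obtain ⟨k, rfl⟩ := Nat.exists_eq_add_of_le hm
    refine hn ⟨f (f^[k] x), hfK _, ?_⟩
    rw [← Function.iterate_succ_apply' f, ← Function.iterate_add_apply,
      show n + 1 + k = n + (k + 1) by omega]

theorem mdifferentiable_subtype_val (X : TopologicalSpace.Opens M) :
    MDifferentiable 𝓘(ℂ, E) 𝓘(ℂ, E) (Subtype.val : X → M) :=
  (contMDiff_subtype_val (n := 1)).mdifferentiable one_ne_zero

theorem mdifferentiable_of_subtype_val_comp {X : TopologicalSpace.Opens M} {f : X → X}
    (h : MDifferentiable 𝓘(ℂ, E) 𝓘(ℂ, E) fun x => (f x : M)) :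
    MDifferentiable 𝓘(ℂ, E) 𝓘(ℂ, E) f := fun x =>
  (ChartedSpace.liftPropWithinAt_subtypeVal_comp_iff f univ x).1 (h x)

end Manifold

theorem mainTheorem4 :
    (∀ (E : Type*) [NormedAddCommGroup E] [NormedSpace ℂ E]
        (A : Type*) [TopologicalSpace A] [ChartedSpace E A],
      IsSteinManifold E A →
      ∀ X : TopologicalSpace.Opens A, IsConnected (X : Set A) →
      ∀ U : Set X, IsOpen U → IsCompact (closure U) →
      ∀ (f : X → X) (hf : MDifferentiable 𝓘(ℂ, E) 𝓘(ℂ, E) f), (∀ x, f x ∈ U) →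
        ∃ c ∈ U, (∀ x : X, f x = x ↔ x = c) ∧
          Filter.Tendsto (fun n : ℕ => (⟨f^[n], hf.continuous.iterate n⟩ : C(X, X)))
            Filter.atTop (𝓝 (ContinuousMap.const X c))) ∧
    (∀ (n : ℕ) (Ω K : Set (EuclideanSpace ℂ (Fin n))),
      IsOpen Ω → IsConnected Ω → IsCompact K → K ⊆ Ω →
      ∀ f : EuclideanSpace ℂ (Fin n) → EuclideanSpace ℂ (Fin n),
        DifferentiableOn ℂ f Ω → (∀ z ∈ Ω, f z ∈ K) →
        ∃! c, c ∈ Ω ∧ f c = c) := by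
  refine ⟨fun E _ _ A _ _ hA X hX U _ hUc f hf hfU => ?_, fun n Ω K hΩ hΩc hK hKΩ f hf hfK => ?_⟩
  · have := hA.finiteDimensional
    have := hA.isManifold
    have : IsManifold 𝓘(ℂ, E) 1 A := IsManifold.of_le (n := ω) le_top
    have := hA.t2Space
    have : ConnectedSpace X := isConnected_iff_connectedSpace.1 hX
    obtain ⟨c, hc, hlim⟩ := hf.exists_fixedPoint_iterate_mem (fun x y hxy => by
      obtain ⟨g, hg, hne⟩ := hA.separates x y (Subtype.coe_injective.ne hxy)
      exact ⟨_, MDifferentiable.comp hg (mdifferentiable_subtype_val X), hne⟩) hUc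
      fun x => subset_closure (hfU x)
    refine ⟨c, hc ▸ hfU c, fun x => ⟨fun hx => ?_, fun hx => hx ▸ hc⟩, ?_⟩
    · exact eq_of_forall_mem_nhds_of_iterate_mem hx hlim
    · rw [ContinuousMap.tendsto_nhds_compactOpen]
      intro L _ W hW hLW
      -- Only a point of L shows that c lies in W.
      obtain rfl | ⟨x, hx⟩ := L.eq_empty_or_nonempty
      · exact Eventually.of_forall fun _ => mapsTo_empty _ _
      · filter_upwards [hlim W (hW.mem_nhds (hLW hx))] with m hm z _ using hm z
  · let X : TopologicalSpace.Opens (EuclideanSpace ℂ (Fin n)) := ⟨Ω, hΩ⟩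
    have : ConnectedSpace X := isConnected_iff_connectedSpace.1 hΩc
    let F : X → X := fun x => ⟨f x, hKΩ (hfK x x.2)⟩
    have hF : MDifferentiable 𝓘(ℂ, EuclideanSpace ℂ (Fin n)) 𝓘(ℂ, EuclideanSpace ℂ (Fin n)) F :=
      mdifferentiable_of_subtype_val_comp fun x =>
        MDifferentiableAt.comp (g := f) (f := Subtype.val) x (hf.differentiableAt (hΩ.mem_nhds x.2)).mdifferentiableAt
          (mdifferentiable_subtype_val X x)
    have hKX : IsCompact ((↑) ⁻¹' K : Set X) :=
      Topology.IsInducing.subtypeVal.isCompact_preimage' hK (by simpa [X] using hKΩ)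
    obtain ⟨c, hc, hlim⟩ := hF.exists_fixedPoint_iterate_mem (fun x y hxy => by
      obtain ⟨i, hi⟩ : ∃ i, (x : EuclideanSpace ℂ (Fin n)) i ≠ (y : EuclideanSpace ℂ (Fin n)) i := by
        by_contra! h
        exact hxy (Subtype.ext (PiLp.ext h))
      exact ⟨_, MDifferentiable.comp (I' := 𝓘(ℂ, EuclideanSpace ℂ (Fin n)))
        (EuclideanSpace.proj (𝕜 := ℂ) i).differentiable.mdifferentiable
        (mdifferentiable_subtype_val X), hi⟩) hKX fun x => hfK x x.2
    refine ⟨c, ⟨c.2, congrArg Subtype.val hc⟩, fun z hz => ?_⟩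
    exact congrArg Subtype.val (eq_of_forall_mem_nhds_of_iterate_mem
      (x := (⟨z, hz.1⟩ : X)) (Subtype.ext hz.2) hlim)
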